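/- Let $\mathbf K$ be an abstract elementary class (models may be taken to be structures in a set-sized language) with the amalgamation property, the joint embedding property and no maximal models. Let $\mu\ge \mathrm{LS}(\mathbf K)$ be a cardinal and write $\mathrm{gS}(M)$ for the set of Galois types (of length one) over $M$, and $K_\mu$ for the class of models of cardinality $\mu$. Conventions. For $M\le N$, $N$ is *universal over* $M$ ($M<_uN$) if $M\neq N$ and every $N'\ge M$ with $\|N'\|=\|N\|$ embeds into $N$ over $M$; $M\le_u N$ means $M<_uN$ or $M=N$. A *$u$-chain* in $K_\mu$ is an increasing continuous chain $\langle M_i:i\le\delta\rangle$ of models in $K_\mu$ with $M_i<_uM_{i+1}$ for all $i<\delta$. A *limit model* in $K_\mu$ is the last member $M_\alpha$ of a $u$-chain $\langle M_i:i\le\alpha\rangle$ in $K_\mu$ for some regular infinite cardinal $\alpha<\mu^+$. A type $p\in\mathrm{gS}(N)$ *$\mu$-splits over* $M\le N$ if there are $N_1,N_2\in K_\mu$ with $M\le N_1,N_2\le N$ and an isomorphism $f:N_1\cong_M N_2$ with $f(p\restriction N_1)\ne p\restriction N_2$. For a regular cardinal $\kappa$, $\mathbf K$ has *$\kappa$-local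 character of $\mu$-nonsplitting* if for every limit ordinal $\delta$ with $\mathrm{cf}(\delta)\ge\kappa$, every $u$-chain $\langle M_i:i\le\delta\rangle$ in $K_\mu$ and every $p\in\mathrm{gS}(M_\delta)$, there is $i<\delta$ such that $p$ does not $\mu$-split over $M_i$. $\mathbf K$ is *$\mu$-superstable* if $\mu\ge\mathrm{LS}(\mathbf K)$, $\mathbf K$ is stable in $\mu$ and $\mathbf K$ has $\aleph_0$-local character of $\mu$-nonsplitting. For $M\le N$ and $p\in\mathrm{gS}(N)$, $p$ *does not $\mu$-fork over* $M$ if there is $M_0\in K_\mu$ with $M_0<_uM$ such that $p$ does not $\mu$-split over $M_0$; otherwise $p$ *$\mu$-forks over* $M$. Assume that 1. $\mathbf K$ is stable in $\mu$, i.e. $|\mathrm{gS}(M)|\le\mu$ for every $M\in K_\mu$; 2. $\mathbf K$ is $\mu$-tame, i.e. distinct Galois types over a model $N$ have distinct restrictions to some $M\le N$ with $\|M\|\le\mu$; 3. $\mathbf K$ has continuity of $\mu$-nonsplitting, i.e. for every limit ordinal $\delta$, every $u$-chain $\langle M_i:i\le\delta\rangle$ in $K_\mu$ and every $p\in\mathrm{gS}(M_\delta)$,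 if $p\restriction M_i$ does not $\mu$-split over $M_0$ for all $i<\delta$, then $p$ does not $\mu$-split over $M_0$; 4. $\chi\le\mu$, where $\chi$ is the least regular cardinal $\kappa$ for which $\mathbf K$ has $\kappa$-local character of $\mu$-nonsplitting. Restrict $\mu$-nonforking to the limit models in $K_\mu$ ordered by $\le_u$, and let $U$ be the associated (Boney–Grossberg) $U$-rank: for a limit model $M\in K_\mu$ and $p\in\mathrm{gS}(M)$, $U(p)\ge0$ always; for $\alpha$ a limit ordinal, $U(p)\ge\alpha$ iff $U(p)\ge\beta$ for all $\beta<\alpha$; and $U(p)\ge\beta+1$ iff there are a limit model $M'\in K_\mu$ with $M\le_uM'$ and $p'\in\mathrm{gS}(M')$ extending $p$ such that $p'$ $\mu$-forks over $M$ and $U(p')\ge\beta$. Put $U(p)=\infty$ if $U(p)\ge\alpha$ for all ordinals $\alpha$, and otherwise let $U(p)$ be the ordinal $\alpha$ with $U(p)\ge\alpha$ and $U(p)\not\ge\alpha+1$. Then $\mathbf K$ is $\mu$-superstable if and only if $U(p)<\infty$ for every limit model $M\in K_\mu$ and every $p\in\mathrm{gS}(M)$. -/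

import Mathlib

universe u

open FirstOrder.Language Cardinal
open scoped FirstOrder

/-- An abstract elementary class in the language `L`: a class `IsModel` of `L`-structures together
with a relation `Strong S` (for `S` a substructure of `N`), read as `S ≤_K N`. The universe `u` plays
the role of the set-theoretic universe, so languages and models are "sets" and `K` is a class. -/
structure AEC (L : FirstOrder.Language.{u, u}) where
  /-- membership in the class -/
  IsModel : ∀ (M : Type u) [L.Structure M], Prop
  /-- `Strong S` means `S ≤_K N`, where `S` is a substructure of `N` -/
  Strong : ∀ {N : Type u} [L.Structure N], L.Substructure N → Prop
  isModel_of_strong : ∀ {N : Type u} [L.Structure N] {S : L.Substructure N}, Strong S → IsModel N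
  isModel_coe_of_strong : ∀ {N : Type u} [L.Structure N] {S : L.Substructure N},
    Strong S → IsModel S
  /-- closure under isomorphism -/
  isModel_of_equiv : ∀ {M N : Type u} [L.Structure M] [L.Structure N],
    (M ≃[L] N) → IsModel M → IsModel N
  strong_map_equiv : ∀ {M N : Type u} [L.Structure M] [L.Structure N] (e : M ≃[L] N)
    {S : L.Substructure M}, Strong S → Strong (S.map e.toHom)
  /-- `≤_K` is reflexive -/
  strong_top : ∀ {N : Type u} [L.Structure N], IsModel N → Strong (⊤ : L.Substructure N)
  /-- `≤_K` is transitive -/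
  strong_trans : ∀ {N : Type u} [L.Structure N] {S : L.Substructure N} {T : L.Substructure S},
    Strong T → Strong S → Strong (T.map S.subtype.toHom)
  /-- coherence: if `S ⊆ T`, `S ≤_K N` and `T ≤_K N`, then `S ≤_K T` -/
  coherence : ∀ {N : Type u} [L.Structure N] {S T : L.Substructure N}, S ≤ T →
    Strong S → Strong T → Strong (S.comap T.subtype.toHom)
  /-- Tarski–Vaught axiom, first part: if `U` is the union of a nonempty well-ordered
  `≤_K`-increasing chain, then `U` is in the class and every member of the chain is `≤_K U` -/
  union_strong : ∀ {ι : Type u} [LinearOrder ι] [WellFoundedLT ι] [Nonempty ι]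
    {U : Type u} [L.Structure U] (S : ι → L.Substructure U),
    (∀ i j, i ≤ j → S i ≤ S j ∧ Strong ((S i).comap (S j).subtype.toHom)) →
    (∀ x : U, ∃ i, x ∈ S i) → IsModel U ∧ ∀ i, Strong (S i)
  /-- Tarski–Vaught axiom, second part (smoothness): if all members of the chain are `≤_K N`,
  then so is their union -/
  union_smooth : ∀ {ι : Type u} [LinearOrder ι] [WellFoundedLT ι] [Nonempty ι]
    {N : Type u} [L.Structure N] (S : ι → L.Substructure N), Monotone S →
    (∀ i, Strong (S i)) → ∀ T : L.Substructure N, (T : Set N) = ⋃ i, (S i : Set N) → Strong T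
  /-- Löwenheim–Skolem axiom -/
  exists_ls : ∃ κ : Cardinal.{u}, ℵ₀ ≤ κ ∧ L.card ≤ κ ∧
    ∀ {N : Type u} [L.Structure N], IsModel N → ∀ A : Set N,
      ∃ S : L.Substructure N, Strong S ∧ A ⊆ S ∧ #S ≤ #A + κ

namespace AEC

variable {L : FirstOrder.Language.{u, u}} (K : AEC L)

/-- The Löwenheim–Skolem number `LS(K)`: the least cardinal `κ ≥ |L| + ℵ₀` for which the
Löwenheim–Skolem axiom holds (the set below is nonempty by `exists_ls`). -/
noncomputable def LS : Cardinal.{u} :=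
  sInf {κ | ℵ₀ ≤ κ ∧ L.card ≤ κ ∧
    ∀ (N : Type u) [L.Structure N], K.IsModel N → ∀ A : Set N,
      ∃ S : L.Substructure N, K.Strong S ∧ A ⊆ S ∧ #S ≤ #A + κ}

/-- A model in the class. -/
structure Model where
  carrier : Type u
  [str : L.Structure carrier]
  isModel : K.IsModel carrier

instance : CoeSort K.Model (Type u) := ⟨Model.carrier⟩

instance (M : K.Model) : L.Structure M := M.str

/-- A `K`-embedding `f : M → N`: an `L`-embedding with `f[M] ≤_K N`. -/
structure Emb (M N : K.Model) where
  toEmbedding : M ↪[L] N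
  strong : K.Strong toEmbedding.toHom.range

variable {K}

instance (M N : K.Model) : CoeFun (K.Emb M N) (fun _ => M → N) := ⟨fun f => f.toEmbedding⟩

/-- Composition of `K`-embeddings: first `f`, then `g`. -/
def Emb.comp {M N P : K.Model} (g : K.Emb N P) (f : K.Emb M N) : K.Emb M P where
  toEmbedding := g.toEmbedding.comp f.toEmbedding
  strong := by
    have h1 := K.strong_map_equiv g.toEmbedding.equivRange f.strong
    have h2 := K.strong_trans h1 g.strong
    convert h2 using 1
    ext x
    simp only [Hom.mem_range, Substructure.mem_map]
    constructor
    · rintro ⟨y, rfl⟩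
      exact ⟨_, ⟨_, ⟨y, rfl⟩, rfl⟩, rfl⟩
    · rintro ⟨_, ⟨_, ⟨y, rfl⟩, rfl⟩, rfl⟩
      exact ⟨y, rfl⟩

/-- An isomorphism, viewed as a `K`-embedding. -/
def Emb.ofEquiv {M N : K.Model} (e : M ≃[L] N) : K.Emb M N where
  toEmbedding := e.toEmbedding
  strong := by
    have : e.toEmbedding.toHom.range = ⊤ := by
      rw [Hom.range_eq_top]
      exact e.surjective
    rw [this]
    exact K.strong_top N.isModel

/-- A `K`-submodel of `N`, i.e. `S ≤_K N`. By coherence, inclusion of submodels of `N` coincides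
with `≤_K` between them. -/
structure Submodel (N : K.Model) where
  toSubstructure : L.Substructure N
  strong : K.Strong toSubstructure

namespace Submodel

variable {N : K.Model}

/-- The underlying set of a submodel. -/
def set (S : Submodel N) : Set N := S.toSubstructure

instance : LE (Submodel N) := ⟨fun S T => S.toSubstructure ≤ T.toSubstructure⟩

/-- A submodel of `N`, as a model in its own right. -/
def model (S : Submodel N) : K.Model where
  carrier := S.toSubstructure
  isModel := K.isModel_coe_of_strong S.strong

/-- The inclusion of a submodel of `N` into `N`. -/
def incl (S : Submodel N) : K.Emb S.model N where
  toEmbedding := S.toSubstructure.subtype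
  strong := by
    have h := Substructure.range_subtype S.toSubstructure
    exact h.symm ▸ S.strong

/-- The inclusion between two submodels `S ≤ T` of `N`. -/
def inclLE {S T : Submodel N} (h : S ≤ T) : K.Emb S.model T.model where
  toEmbedding := Substructure.inclusion h
  strong := by
    have h1 : K.Strong (S.toSubstructure.comap T.toSubstructure.subtype.toHom) :=
      K.coherence h S.strong T.strong
    have h2 : (Substructure.inclusion h).toHom.range =
        S.toSubstructure.comap T.toSubstructure.subtype.toHom := by
      ext x
      simp only [Hom.mem_range, Substructure.mem_comap]
      constructor
      · rintro ⟨y, rfl⟩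
        exact y.2
      · intro hx
        exact ⟨⟨x.1, hx⟩, rfl⟩
    exact h2.symm ▸ h1

end Submodel

variable (K)

/-- The amalgamation property. -/
def AP : Prop :=
  ∀ (M N₁ N₂ : K.Model) (f₁ : K.Emb M N₁) (f₂ : K.Emb M N₂),
    ∃ (N : K.Model) (g₁ : K.Emb N₁ N) (g₂ : K.Emb N₂ N), ∀ m : M, g₁ (f₁ m) = g₂ (f₂ m)

/-- The joint embedding property. -/
def JEP : Prop :=
  ∀ M₁ M₂ : K.Model, ∃ N : K.Model, Nonempty (K.Emb M₁ N) ∧ Nonempty (K.Emb M₂ N)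

/-- No maximal models. -/
def NMM : Prop :=
  ∀ M : K.Model, ∃ (N : K.Model) (f : K.Emb M N), ¬ Function.Surjective f

variable {K}

/-- A triple representing a Galois type over `M`: an extension of `M` and an element of it. -/
structure TypeRep (M : K.Model) where
  amb : K.Model
  emb : K.Emb M amb
  pt : amb

/-- Two triples are identified if their ambient models can be amalgamated over `M` with the two
distinguished elements having the same image. -/
def TypeRep.Rel {M : K.Model} (a b : TypeRep M) : Prop :=
  ∃ (N : K.Model) (g : K.Emb a.amb N) (h : K.Emb b.amb N),
    (∀ m : M, g (a.emb m) = h (b.emb m)) ∧ g a.pt = h b.pt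

/-- `gS(M)`, the Galois types (of length one) over `M`: triples modulo the equivalence relation
generated by `TypeRep.Rel`. -/
def GType (M : K.Model) : Type (u + 1) := Quot (TypeRep.Rel (M := M))

namespace GType

/-- The restriction to `M` of a Galois type over `N`, along a `K`-embedding `f : M → N`
(the usual restriction `p ↾ M` when `f` is an inclusion). -/
def restrict {M N : K.Model} (f : K.Emb M N) : GType N → GType M :=
  Quot.map (fun a => ⟨a.amb, a.emb.comp f, a.pt⟩)
    (fun _ _ ⟨P, g, h, hm, hp⟩ => ⟨P, g, h, fun m => hm (f m), hp⟩)

/-- The image `f(p)` of a Galois type over `M` under an isomorphism `f : M ≃ N`. -/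
def map {M N : K.Model} (f : M ≃[L] N) (p : GType M) : GType N :=
  p.restrict (Emb.ofEquiv f.symm)

end GType

/-- `N` is universal over `M` (`M <_u N`), where `M` is embedded in `N` by `i`: the extension is
proper and every extension of `M` of cardinality `‖N‖` embeds into `N` over `M`. -/
def IsUniversal {M N : K.Model} (i : K.Emb M N) : Prop :=
  ¬ Function.Surjective i ∧
    ∀ (N' : K.Model) (j : K.Emb M N'), #N' = #N → ∃ g : K.Emb N' N, ∀ m : M, g (j m) = i m

/-- `⟨S i : i ≤ δ⟩` is an increasing continuous chain of models in `K_lam` with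
`S (i+1)` universal over `S i` for `i < δ`, and with last member `S δ = N`
(values of `S` above `δ` are irrelevant). -/
structure IsUChain (lam : Cardinal.{u}) (δ : Ordinal.{u}) (N : K.Model)
    (S : Ordinal.{u} → Submodel N) : Prop where
  mono : ∀ i j, i ≤ j → j ≤ δ → S i ≤ S j
  card : ∀ i ≤ δ, #(S i).model = lam
  cont : ∀ i ≤ δ, Order.IsSuccLimit i → (S i).set = ⋃ j ∈ Set.Iio i, (S j).set
  univ : ∀ i < δ, ∃ h : S i ≤ S (i + 1), IsUniversal (Submodel.inclLE h)
  last : (S δ).set = Set.univ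

/-- `N` is a limit model in `K_lam`, i.e. a `(lam, α)`-limit over some `M ∈ K_lam`, for some regular
`α < lam⁺`. -/
def IsLimitModel (lam : Cardinal.{u}) (N : K.Model) : Prop :=
  ∃ α : Cardinal.{u}, α.IsRegular ∧ α < Order.succ lam ∧
    ∃ S : Ordinal.{u} → Submodel N, IsUChain lam α.ord N S

/-- `p ∈ gS(N)` `μ`-splits over `M`, where `M` is embedded in `N` by `i`: there are
`M ≤ N₁, N₂ ≤ N` of size `μ` and an isomorphism `f : N₁ ≃ N₂` over `M` with
`f(p) ↾ N₂ ≠ p ↾ N₂`. -/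
def Splits (μ : Cardinal.{u}) {M N : K.Model} (i : K.Emb M N) (p : GType N) : Prop :=
  ∃ (N₁ N₂ : Submodel N) (h₁ : ∀ m : M, i m ∈ N₁.set) (h₂ : ∀ m : M, i m ∈ N₂.set)
    (f : N₁.model ≃[L] N₂.model),
    #N₁.model = μ ∧ #N₂.model = μ ∧ (∀ m : M, f ⟨i m, h₁ m⟩ = ⟨i m, h₂ m⟩) ∧
    (p.restrict N₁.incl).map f ≠ p.restrict N₂.incl

/-- `p ∈ gS(N)` does not `μ`-fork over `M`, where `M` is embedded in `N` by `i`: there is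
`M₀ ∈ K_μ` with `M₀ <_u M` such that `p` does not `μ`-split over `M₀`. -/
def DoesNotFork (μ : Cardinal.{u}) {M N : K.Model} (i : K.Emb M N) (p : GType N) : Prop :=
  ∃ M₀ : Submodel M, #M₀.model = μ ∧ IsUniversal M₀.incl ∧ ¬ Splits μ (i.comp M₀.incl) p

variable (K)

/-- `K` is stable in `lam`. -/
def StableIn (lam : Cardinal.{u}) : Prop :=
  ∀ M : K.Model, #M = lam → #(GType M) ≤ Cardinal.lift.{u + 1} lam

/-- `K` is `lam`-tame: distinct Galois types over a model have distinct restrictions to some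
submodel of size at most `lam`. -/
def Tame (lam : Cardinal.{u}) : Prop :=
  ∀ (N : K.Model) (p q : GType N), p ≠ q →
    ∃ M : Submodel N, #M.model ≤ lam ∧ p.restrict M.incl ≠ q.restrict M.incl

/-- Continuity of `μ`-nonsplitting. -/
def ContinuityNonsplitting (μ : Cardinal.{u}) : Prop :=
  ∀ (δ : Ordinal.{u}) (N : K.Model) (S : Ordinal.{u} → Submodel N), Order.IsSuccLimit δ →
    IsUChain μ δ N S → ∀ p : GType N,
    (∀ i < δ, ∀ h : S 0 ≤ S i, ¬ Splits μ (Submodel.inclLE h) (p.restrict (S i).incl)) →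
    ¬ Splits μ (S 0).incl p

/-- `χ`-local character of `μ`-nonsplitting: a type over the union of a `u`-increasing continuous
chain in `K_μ`, of limit length of cofinality at least `χ`, does not `μ`-split over some member. -/
def LocalCharacter (χ μ : Cardinal.{u}) : Prop :=
  ∀ (δ : Ordinal.{u}) (N : K.Model) (S : Ordinal.{u} → Submodel N), Order.IsSuccLimit δ → χ ≤ δ.cof →
    IsUChain μ δ N S → ∀ p : GType N, ∃ i < δ, ¬ Splits μ (S i).incl p

/-- `χ` is the minimum local character cardinal of `μ`-nonsplitting. -/
def IsMinLocalCharacter (χ μ : Cardinal.{u}) : Prop :=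
  IsLeast {κ : Cardinal.{u} | κ.IsRegular ∧ K.LocalCharacter κ μ} χ

/-- `K` is `lam`-superstable (for `lam ≥ LS(K)`): stable in `lam`, with `ℵ₀`-local character of
`lam`-nonsplitting. -/
def Superstable (lam : Cardinal.{u}) : Prop :=
  K.LS ≤ lam ∧ K.StableIn lam ∧ K.LocalCharacter ℵ₀ lam

/-- The data of an independence relation on Galois types of length one over the models of a
subclass `dom` of `K`, ordered by `le`: `indep i p` says that `p ∈ gS(N)` is independent over `M`,
where `i` embeds `M` in `N`. -/
structure IndepRel where
  dom : K.Model → Prop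
  le : ∀ {M N : K.Model}, K.Emb M N → Prop
  indep : ∀ {M N : K.Model}, K.Emb M N → GType N → Prop

/-- `μ`-nonforking restricted to the limit models in `K_μ`, ordered by `≤_u` (universal extension or
equality). -/
def limitNonforking (μ : Cardinal.{u}) : K.IndepRel where
  dom := IsLimitModel μ
  le := fun i => IsUniversal i ∨ Function.Surjective i
  indep := fun i p => DoesNotFork μ i p

variable {K}

/-- `p' ∈ gS(M')` is a forking extension of `p ∈ gS(M)` in the sense of `D`, along `i : M → M'`. -/
def IndepRel.IsForkingExt (D : K.IndepRel) {M M' : K.Model} (i : K.Emb M M') (p : GType M)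
    (p' : GType M') : Prop :=
  D.dom M' ∧ D.le i ∧ p'.restrict i = p ∧ ¬ D.indep i p'

/-- `D.URankGE α M p` is `U(p) ≥ α`, where `p ∈ gS(M)`, by recursion on `α`. -/
noncomputable def IndepRel.URankGE (D : K.IndepRel) (α : Ordinal.{u}) :
    ∀ M : K.Model, GType M → Prop :=
  Ordinal.limitRecOn (motive := fun _ => ∀ M : K.Model, GType M → Prop) α
    (fun _ _ => True)
    (fun _ geβ M p => ∃ (M' : K.Model) (i : K.Emb M M') (p' : GType M'),
      #M' = #M ∧ D.IsForkingExt i p p' ∧ geβ M' p')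
    (fun α _ ge M p => ∀ (β : Ordinal.{u}) (hβ : β < α), ge β hβ M p)

open Classical in
/-- The `U`-rank of `p`, with `⊤` in the role of `∞`: it is `∞` if `U(p) ≥ α` for all ordinals `α`,
and otherwise the least `α` with `U(p) ≱ α + 1`. -/
noncomputable def IndepRel.URank (D : K.IndepRel) {M : K.Model} (p : GType M) :
    WithTop Ordinal.{u} :=
  if ∀ α, D.URankGE α M p then ⊤ else ((sInf {α | ¬ D.URankGE (α + 1) M p} : Ordinal.{u}) :
    WithTop Ordinal.{u})

section URank

variable (D : K.IndepRel) {M : K.Model} (p : GType M)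

theorem IndepRel.uRankGE_zero : D.URankGE 0 M p := by
  simp [IndepRel.URankGE]

theorem IndepRel.uRankGE_add_one (β : Ordinal.{u}) : D.URankGE (β + 1) M p ↔
    ∃ (M' : K.Model) (i : K.Emb M M') (p' : GType M'),
      #M' = #M ∧ D.IsForkingExt i p p' ∧ D.URankGE β M' p' := by
  simp [IndepRel.URankGE]

theorem IndepRel.uRankGE_limit (α : Ordinal.{u}) (hα : Order.IsSuccLimit α) :
    D.URankGE α M p ↔ ∀ β < α, D.URankGE β M p := by
  unfold IndepRel.URankGE
  rw [Ordinal.limitRecOn_limit _ _ _ _ hα]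

theorem IndepRel.uRankGE_of_add_one (β : Ordinal.{u}) :
    ∀ (M : K.Model) (p : GType M), D.URankGE (β + 1) M p → D.URankGE β M p := by
  induction β using Ordinal.limitRecOn with
  | zero => exact fun M p _ => D.uRankGE_zero p
  | add_one γ ih =>
    intro M p h
    obtain ⟨M', i, p', hc, hf, hp⟩ := (D.uRankGE_add_one p _).1 h
    exact (D.uRankGE_add_one p _).2 ⟨M', i, p', hc, hf, ih M' p' hp⟩
  | limit α hα ih =>
    intro M p h
    obtain ⟨M', i, p', hc, hf, hp⟩ := (D.uRankGE_add_one p _).1 h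
    refine (D.uRankGE_limit p α hα).2 fun β hβ => ih β hβ M p ?_
    exact (D.uRankGE_add_one p _).2 ⟨M', i, p', hc, hf, (D.uRankGE_limit p' α hα).1 hp β hβ⟩

theorem IndepRel.uRankGE_antitone {α β : Ordinal.{u}} (h : α ≤ β) (hp : D.URankGE β M p) :
    D.URankGE α M p := by
  induction β using Ordinal.limitRecOn with
  | zero =>
    obtain rfl : α = 0 := le_antisymm h (zero_le)
    exact hp
  | add_one γ ih =>
    rcases h.eq_or_lt with rfl | h
    · exact hp
    · exact ih (Order.lt_add_one_iff.1 h) (D.uRankGE_of_add_one γ M p hp)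
  | limit γ hγ ih =>
    rcases h.eq_or_lt with rfl | h
    · exact hp
    · exact (D.uRankGE_limit p γ hγ).1 hp α h

/-- The value `URank p` is consistent with the relation `U(p) ≥ α`. -/
theorem IndepRel.le_uRank_iff (α : Ordinal.{u}) :
    (α : WithTop Ordinal.{u}) ≤ D.URank p ↔ D.URankGE α M p := by
  classical
  unfold IndepRel.URank
  split_ifs with h
  · simp [h α]
  · push Not at h
    obtain ⟨γ, hγ⟩ := h
    have hne : {α | ¬ D.URankGE (α + 1) M p}.Nonempty :=
      ⟨γ, fun h' => hγ (D.uRankGE_of_add_one γ M p h')⟩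
    rw [WithTop.coe_le_coe]
    constructor
    · intro hα
      induction α using Ordinal.limitRecOn with
      | zero => exact D.uRankGE_zero p
      | add_one β _ =>
        by_contra hβ
        exact absurd (csInf_le' (s := {α | ¬ D.URankGE (α + 1) M p}) hβ)
          (not_le.2 (lt_of_lt_of_le (Order.lt_add_one_iff.2 le_rfl) hα))
      | limit β hβ ih =>
        exact (D.uRankGE_limit p β hβ).2 fun c hc => ih c hc (hc.le.trans hα)
    · intro hα
      by_contra hlt
      exact csInf_mem hne (D.uRankGE_antitone p (Order.add_one_le_of_lt (not_le.1 hlt)) hα)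

end URank

end AEC

/-!
The rank is a well-foundedness rank for forking extensions of types over limit models, so the
theorem compares infinite sequences of forking extensions with failures of `ℵ₀`-local character.

Splitting is handled through the reformulation `AEC.splits_iff`: a type over `N` splits over `M`
when two embeddings into `N` of some model of size `μ`, agreeing on a copy of `M`, restrict it to
different types. This makes the monotonicity of splitting in the base and in the type immediate, and
shows that it is invariant under isomorphism.

*Superstability implies ordinal ranks* (`AEC.Superstable.uRank_lt_top`). By stability there is, up
to isomorphism, only a set of types over models of size `μ`; hence the ordinal ranks are bounded and
a type of infinite rank has a forking extension of infinite rank. Iterating gives an `ω`-sequence of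
forking extensions. Each step is a universal extension, since by local character along the chain
witnessing that `M` is a limit model no type over `M` forks over `M` itself. Realizing the types
coherently and passing to the direct limit of the ambient models gives a type over the union of the
sequence. By `ℵ₀`-local character it does not split over the `n`-th model, so the type over the
model `n + 2` does not fork over the model `n + 1`, which is a contradiction
(`AEC.not_exists_forking_sequence`).

*Ordinal ranks imply superstability* (`AEC.localCharacter_of_uRank_lt_top`). Suppose that `p` splits
over every member of a `u`-chain `⟨S i : i ≤ δ⟩`. By continuity of nonsplitting, for each `i < δ`
there is `j` with `i < j < δ` such that the restriction of `p` to `S j` splits over `S i`. The limit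
model `S (j + ω)` embeds into `S (j + 1)` over `S j` by universality. So there is always
a copy of a limit model between `S j` and `S (j + 1)`, and the restriction of `p` to such a copy for
a suitable later `j` forks over a given earlier copy. By induction on `α` all of them have rank at least `α`, for every `α`
(`AEC.uRankGE_of_forall_splits`).
-/

namespace AEC

variable {L : FirstOrder.Language.{u, u}} {K : AEC L}

/-! ### Embeddings and submodels -/

namespace Emb

variable {M N P : K.Model}

@[ext]
theorem ext {f g : K.Emb M N} (h : ∀ m, f m = g m) : f = g := by
  obtain ⟨f, hf⟩ := f
  obtain ⟨g, hg⟩ := g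
  obtain rfl : f = g := DFunLike.ext _ _ h
  rfl

@[simp]
theorem comp_apply (g : K.Emb N P) (f : K.Emb M N) (m : M) : g.comp f m = g (f m) := rfl

@[simp]
theorem ofEquiv_apply (e : M ≃[L] N) (m : M) : ofEquiv e m = e m := rfl

theorem injective (f : K.Emb M N) : Function.Injective f := f.toEmbedding.injective

/-- The image of a `K`-embedding, as a submodel of the target. -/
def range (f : K.Emb M N) : Submodel N := ⟨f.toEmbedding.toHom.range, f.strong⟩

/-- A `K`-embedding is an isomorphism onto its image. -/
noncomputable def equivRange (f : K.Emb M N) : M ≃[L] f.range.model := f.toEmbedding.equivRange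

@[simp]
theorem incl_equivRange (f : K.Emb M N) (m : M) : f.range.incl (f.equivRange m) = f m := rfl

theorem mem_range {f : K.Emb M N} {x : N} : x ∈ f.range.set ↔ ∃ m, f m = x := Iff.rfl

/-- A `K`-embedding into `P` whose image is contained in the image of another one factors
through it, by coherence. -/
theorem exists_factor (f : K.Emb M P) (g : K.Emb N P) (h : ∀ m, ∃ n, g n = f m) :
    ∃ k : K.Emb M N, ∀ m, g (k m) = f m := by
  have hle : f.range ≤ g.range := by
    rintro _ ⟨m, rfl⟩
    exact h m
  refine ⟨(ofEquiv g.equivRange.symm).comp ((Submodel.inclLE hle).comp (ofEquiv f.equivRange)),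
    fun m => ?_⟩
  have := g.incl_equivRange (g.equivRange.symm (Submodel.inclLE hle (f.equivRange m)))
  rw [FirstOrder.Language.Equiv.apply_symm_apply] at this
  exact this.symm

theorem mk_range_model (f : K.Emb M N) : #f.range.model = #M :=
  (Cardinal.mk_congr f.equivRange.toEquiv).symm

/-- A bijective `K`-embedding is an isomorphism. -/
theorem exists_equiv (f : K.Emb M N) (hf : Function.Surjective f) :
    ∃ e : M ≃[L] N, ofEquiv e = f := by
  refine ⟨⟨_root_.Equiv.ofBijective f ⟨f.injective, hf⟩, fun F x => f.toEmbedding.map_fun F x,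
    fun R x => f.toEmbedding.map_rel R x⟩, ?_⟩
  ext m
  rfl

end Emb

namespace Submodel

variable {N : K.Model}

theorem incl_comp_inclLE {S T : Submodel N} (h : S ≤ T) : T.incl.comp (inclLE h) = S.incl := rfl

theorem mem_set_iff {S : Submodel N} {x : N} : x ∈ S.set ↔ ∃ y, S.incl y = x :=
  ⟨fun h => ⟨⟨x, h⟩, rfl⟩, fun ⟨y, h⟩ => h ▸ y.2⟩

end Submodel

/-! ### Galois types -/

/-- Under amalgamation, equality of Galois types is witnessed by a single amalgam. -/
theorem TypeRep.equivalence_rel (hAP : K.AP) (M : K.Model) :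
    Equivalence (TypeRep.Rel (M := M)) where
  refl a := ⟨a.amb, Emb.ofEquiv (.refl L _), Emb.ofEquiv (.refl L _), fun _ => rfl, rfl⟩
  symm := fun ⟨N, g, h, hm, hp⟩ => ⟨N, h, g, fun m => (hm m).symm, hp.symm⟩
  trans := by
    rintro a b c ⟨N, g, h, hm, hp⟩ ⟨N', g', h', hm', hp'⟩
    obtain ⟨P, k, k', hk⟩ := hAP b.amb N N' h g'
    refine ⟨P, k.comp g, k'.comp h', fun m => ?_, ?_⟩
    · simp [hm, hk, hm']
    · simp [hp, hk, hp']

namespace GType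

theorem mk_eq_mk_iff (hAP : K.AP) {M : K.Model} {a b : TypeRep M} :
    (Quot.mk _ a : GType M) = Quot.mk _ b ↔ TypeRep.Rel a b := by
  rw [Quot.eq, (TypeRep.equivalence_rel hAP M).eqvGen_iff]

variable {M N P : K.Model}

theorem restrict_restrict (f : K.Emb M N) (g : K.Emb N P) (p : GType P) :
    (p.restrict g).restrict f = p.restrict (g.comp f) := by
  induction p using Quot.ind
  rfl

/-- Enlarging the ambient model of a triple does not change the type it represents. -/
theorem mk_eq_mk_of_emb {a b : TypeRep M} (g : K.Emb a.amb b.amb)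
    (hm : ∀ m, g (a.emb m) = b.emb m) (hp : g a.pt = b.pt) :
    (Quot.mk _ a : GType M) = Quot.mk _ b :=
  Quot.sound ⟨b.amb, g, Emb.ofEquiv (.refl L _), hm, hp⟩

theorem restrict_mk (f : K.Emb M N) (a : TypeRep N) :
    GType.restrict f (Quot.mk _ a) = Quot.mk _ ⟨a.amb, a.emb.comp f, a.pt⟩ := rfl

theorem restrict_map (e : M ≃[L] N) (p : GType M) : (p.map e).restrict (Emb.ofEquiv e) = p := by
  rw [map, restrict_restrict]
  induction p using Quot.ind with
  | mk a =>
    have : a.emb.comp ((Emb.ofEquiv e.symm).comp (Emb.ofEquiv e)) = a.emb := by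
      ext m
      simp
    rw [restrict_mk, this]

end GType

/-! ### Splitting -/

/-- Splitting in terms of embeddings: `p` splits over `M` when two embeddings of a model of size
`μ` that agree on a copy of `M` restrict `p` to different types. -/
theorem splits_iff {μ : Cardinal.{u}} {M N : K.Model} {i : K.Emb M N} {p : GType N} :
    Splits μ i p ↔ ∃ (Q : K.Model) (g₁ g₂ : K.Emb Q N), #Q = μ ∧
      (∀ m, ∃ x, g₁ x = i m ∧ g₂ x = i m) ∧ p.restrict g₁ ≠ p.restrict g₂ := by
  constructor
  · rintro ⟨N₁, N₂, h₁, h₂, f, hc, -, hf, hp⟩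
    refine ⟨N₁.model, N₁.incl, N₂.incl.comp (Emb.ofEquiv f), hc,
      fun m => ⟨⟨i m, h₁ m⟩, rfl, congrArg N₂.incl (hf m)⟩, fun h => hp ?_⟩
    rw [GType.map, h, GType.restrict_restrict]
    congr 1
    ext m
    simp
  · rintro ⟨Q, g₁, g₂, hc, hg, hp⟩
    refine ⟨g₁.range, g₂.range, fun m => Emb.mem_range.2 ((hg m).imp fun _ h => h.1),
      fun m => Emb.mem_range.2 ((hg m).imp fun _ h => h.2), g₂.equivRange.comp g₁.equivRange.symm,
      g₁.mk_range_model.trans hc, g₂.mk_range_model.trans hc, fun m => ?_, fun h => hp ?_⟩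
    · obtain ⟨x, hx, hx'⟩ := hg m
      have e : g₁.equivRange.symm ⟨i m, Emb.mem_range.2 ((hg m).imp fun _ h => h.1)⟩ = x :=
        g₁.equivRange.injective
          ((g₁.equivRange.apply_symm_apply _).trans (Subtype.ext hx.symm))
      refine (congrArg g₂.equivRange e).trans ?_
      exact Subtype.ext hx'
    · have h' := congrArg (GType.restrict (Emb.ofEquiv g₂.equivRange)) h
      rw [GType.map, GType.restrict_restrict, GType.restrict_restrict,
        GType.restrict_restrict] at h'
      have e₁ : g₁.range.incl.comp ((Emb.ofEquiv
          (g₂.equivRange.comp g₁.equivRange.symm).symm).comp (Emb.ofEquiv g₂.equivRange)) = g₁ := by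
        ext x
        have : (g₂.equivRange.comp g₁.equivRange.symm).symm (g₂.equivRange x) =
            g₁.equivRange x := by
          apply (g₂.equivRange.comp g₁.equivRange.symm).injective
          rw [FirstOrder.Language.Equiv.apply_symm_apply]
          exact congrArg g₂.equivRange (g₁.equivRange.symm_apply_apply x).symm
        exact congrArg g₁.range.incl this
      have e₂ : g₂.range.incl.comp (Emb.ofEquiv g₂.equivRange) = g₂ := rfl
      rwa [e₁, e₂] at h'

/-- A type that splits over a model splits over each of its submodels. -/
theorem Splits.mono_base {μ : Cardinal.{u}} {M M' N : K.Model} {i : K.Emb M N} {j : K.Emb M' N}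
    {p : GType N} (h : Splits μ j p) (hij : ∀ m, ∃ m', j m' = i m) : Splits μ i p := by
  obtain ⟨Q, g₁, g₂, hc, hg, hp⟩ := splits_iff.1 h
  refine splits_iff.2 ⟨Q, g₁, g₂, hc, fun m => ?_, hp⟩
  obtain ⟨m', hm'⟩ := hij m
  exact hm' ▸ hg m'

/-- A type with a splitting restriction splits. -/
theorem Splits.of_restrict {μ : Cardinal.{u}} {M N P : K.Model} {i : K.Emb M N} {k : K.Emb N P}
    {p : GType P} (h : Splits μ i (p.restrict k)) : Splits μ (k.comp i) p := by
  obtain ⟨Q, g₁, g₂, hc, hg, hp⟩ := splits_iff.1 h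
  refine splits_iff.2 ⟨Q, k.comp g₁, k.comp g₂, hc, fun m => ?_, ?_⟩
  · obtain ⟨x, h₁, h₂⟩ := hg m
    exact ⟨x, congrArg k h₁, congrArg k h₂⟩
  · rwa [GType.restrict_restrict, GType.restrict_restrict] at hp

/-! ### Universal extensions -/

theorem LS_spec (K : AEC L) : ℵ₀ ≤ K.LS ∧ L.card ≤ K.LS ∧
    ∀ (N : Type u) [L.Structure N], K.IsModel N → ∀ A : Set N,
      ∃ S : L.Substructure N, K.Strong S ∧ A ⊆ S ∧ #S ≤ #A + K.LS := by
  obtain ⟨κ, hκ⟩ := K.exists_ls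
  exact csInf_mem (s := {κ | ℵ₀ ≤ κ ∧ L.card ≤ κ ∧ ∀ (N : Type u) [L.Structure N],
    K.IsModel N → ∀ A : Set N, ∃ S : L.Substructure N, K.Strong S ∧ A ⊆ S ∧ #S ≤ #A + κ}) ⟨κ, hκ⟩

theorem aleph0_le_LS : ℵ₀ ≤ K.LS := K.LS_spec.1

/-- The downward Löwenheim–Skolem axiom at `LS(K)`. -/
theorem exists_submodel (N : K.Model) (A : Set N) :
    ∃ S : Submodel N, A ⊆ S.set ∧ #S.model ≤ #A + K.LS := by
  obtain ⟨S, hS, hA, hc⟩ := K.LS_spec.2.2 N N.isModel A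
  exact ⟨⟨S, hS⟩, hA, hc⟩

section Universal

variable {M N N' : K.Model}

/-- An extension of a universal extension by a model of the same size is universal. -/
theorem IsUniversal.comp_left {i : K.Emb M N} (h : IsUniversal i) (k : K.Emb N N')
    (hc : #N' = #N) : IsUniversal (k.comp i) := by
  refine ⟨fun hs => h.1 fun n => ?_, fun Q j hQ => ?_⟩
  · obtain ⟨m, hm⟩ := hs (k n)
    exact ⟨m, k.injective hm⟩
  · obtain ⟨g, hg⟩ := h.2 Q j (hQ.trans hc)
    exact ⟨k.comp g, fun m => congrArg k (hg m)⟩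

/-- A universal extension of `M` is universal over each submodel of `M`: a competing extension is
first amalgamated with `M`. -/
theorem IsUniversal.comp_right (hAP : K.AP) {M₀ : K.Model} {i : K.Emb M N} (h : IsUniversal i)
    (hN : K.LS ≤ #N) (l : K.Emb M₀ M) : IsUniversal (i.comp l) := by
  refine ⟨fun hs => h.1 fun n => ?_, fun Q j hQ => ?_⟩
  · obtain ⟨m, hm⟩ := hs n
    exact ⟨l m, hm⟩
  obtain ⟨P, g₁, g₂, hg⟩ := hAP M₀ Q M j l
  have hM : #M ≤ #N := Cardinal.mk_le_of_injective i.injective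
  have hN₀ : ℵ₀ ≤ #N := aleph0_le_LS.trans hN
  obtain ⟨S, hS, hSc⟩ := exists_submodel P (Set.range g₁ ∪ Set.range g₂)
  obtain ⟨k₁, hk₁⟩ := g₁.exists_factor S.incl fun m =>
    Submodel.mem_set_iff.1 (hS (.inl ⟨m, rfl⟩))
  obtain ⟨k₂, hk₂⟩ := g₂.exists_factor S.incl fun m =>
    Submodel.mem_set_iff.1 (hS (.inr ⟨m, rfl⟩))
  have hc : #S.model = #N := by
    refine le_antisymm (hSc.trans ?_)
      (hQ ▸ Cardinal.mk_le_of_injective k₁.injective)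
    refine Cardinal.add_le_of_le hN₀ ((Cardinal.mk_union_le _ _).trans
      (Cardinal.add_le_of_le hN₀ ?_ ?_)) hN
    · exact Cardinal.mk_range_le.trans hQ.le
    · exact Cardinal.mk_range_le.trans hM
  obtain ⟨g, hg'⟩ := h.2 S.model k₂ hc
  refine ⟨g.comp k₁, fun m => ?_⟩
  have : k₁ (j m) = k₂ (l m) := S.incl.injective (by rw [hk₁, hk₂, hg])
  simp [this, hg']

end Universal

/-! ### Nonforking -/

/-- Nonforking in terms of an arbitrary embedding of the base of nonsplitting. -/
theorem DoesNotFork.of_emb (hAP : K.AP) {μ : Cardinal.{u}} (hμ : K.LS ≤ μ) {M₀ M N : K.Model}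
    {i : K.Emb M N} {p : GType N} (j : K.Emb M₀ M) (h₀ : #M₀ = μ) (hM : #M = μ)
    (hj : IsUniversal j) (hp : ¬ Splits μ (i.comp j) p) : DoesNotFork μ i p := by
  refine ⟨j.range, j.mk_range_model.trans h₀, ?_, fun h => hp (h.mono_base fun m =>
    ⟨j.equivRange m, rfl⟩)⟩
  convert hj.comp_right hAP (hM ▸ hμ) (Emb.ofEquiv j.equivRange.symm) using 1
  ext x
  obtain ⟨y, rfl⟩ := j.equivRange.surjective x
  simp

/-! ### Unions of `ω`-chains -/

/-- The composite `N m → N n` of a sequence of `K`-embeddings is a `K`-embedding. -/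
theorem strong_range_natLERec {N : ℕ → K.Model} (f : ∀ n, K.Emb (N n) (N (n + 1))) {m n : ℕ}
    (h : m ≤ n) :
    K.Strong (DirectedSystem.natLERec (fun n => (f n).toEmbedding) m n h).toHom.range := by
  suffices ∃ e : K.Emb (N m) (N n),
      ∀ x, e x = DirectedSystem.natLERec (fun n => (f n).toEmbedding) m n h x by
    obtain ⟨e, he⟩ := this
    convert e.strong using 3
    exact DFunLike.ext _ _ fun x => (he x).symm
  induction n, h using Nat.le_induction with
  | base =>
    refine ⟨Emb.ofEquiv (.refl L _), fun x => ?_⟩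
    rw [DirectedSystem.coe_natLERec]
    exact (Nat.leRecOn_self (C := fun n => N n) x).symm
  | succ n h ih =>
    obtain ⟨e, he⟩ := ih
    refine ⟨(f n).comp e, fun x => ?_⟩
    rw [Emb.comp_apply, he, DirectedSystem.coe_natLERec, DirectedSystem.coe_natLERec]
    exact (Nat.leRecOn_succ (C := fun n => N n) h x).symm

/-- A sequence of `K`-embeddings has a direct limit in the class. -/
theorem exists_colimit {N : ℕ → K.Model} (f : ∀ n, K.Emb (N n) (N (n + 1))) :
    ∃ (U : K.Model) (g : ∀ n, K.Emb (N n) U), ∀ n x, g (n + 1) (f n x) = g n x := by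
  let F := DirectedSystem.natLERec (fun n => (f n).toEmbedding)
  let U := FirstOrder.Language.DirectLimit (fun n => (N n).carrier) F
  let g : ∀ n, (N n).carrier ↪[L] U :=
    FirstOrder.Language.DirectLimit.of L ℕ (fun n => (N n).carrier) F
  have hg : ∀ m n (h : m ≤ n) x, g n (F m n h x) = g m x := fun m n h x =>
    FirstOrder.Language.DirectLimit.of_f
  have key := K.union_strong (ι := ULift.{u} ℕ) (U := U) (fun n => (g n.down).toHom.range) ?_ ?_
  · refine ⟨⟨U, key.1⟩, fun n => ⟨g n, key.2 ⟨n⟩⟩, fun n x => ?_⟩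
    have := hg n (n + 1) n.le_succ x
    have hF : F n (n + 1) n.le_succ x = f n x := by
      simp only [F, DirectedSystem.coe_natLERec]
      exact Nat.leRecOn_succ' (C := fun n => N n) x
    rwa [hF] at this
  · rintro ⟨m⟩ ⟨n⟩ h
    have h : m ≤ n := h
    refine ⟨?_, ?_⟩
    · rintro _ ⟨x, rfl⟩
      exact ⟨F m n h x, hg m n h x⟩
    · convert K.strong_map_equiv (g n).equivRange (strong_range_natLERec f h) using 1
      ext x
      simp only [Substructure.mem_comap, Hom.mem_range, Substructure.mem_map]
      constructor
      · rintro ⟨y, hy⟩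
        exact ⟨_, ⟨y, rfl⟩, Subtype.ext ((hg m n h y).trans hy)⟩
      · rintro ⟨_, ⟨y, rfl⟩, rfl⟩
        exact ⟨y, (hg m n h y).symm⟩
  · intro x
    obtain ⟨n, y, h⟩ := FirstOrder.Language.DirectLimit.exists_of x
    exact ⟨⟨n⟩, y, h⟩

/-- The union of an increasing sequence of submodels is a submodel, by smoothness. -/
theorem exists_union {N : K.Model} (A : ℕ → Submodel N) (hA : ∀ n, A n ≤ A (n + 1)) :
    ∃ T : Submodel N, T.set = ⋃ n, (A n).set := by
  have hmono : Monotone fun n => (A n).toSubstructure := monotone_nat_of_le_succ hA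
  refine ⟨⟨⨆ n, (A n).toSubstructure, K.union_smooth (ι := ULift.{u} ℕ)
    (fun n => (A n.down).toSubstructure) (fun m n h => hmono h) (fun n => (A n.down).strong) _ ?_⟩,
    ?_⟩
  all_goals
    ext x
    simp only [Submodel.set, SetLike.mem_coe, Set.mem_iUnion,
      Substructure.mem_iSup_of_directed hmono.directed_le]
  exact ⟨fun ⟨n, h⟩ => ⟨⟨n⟩, h⟩, fun ⟨n, h⟩ => ⟨n.down, h⟩⟩

/-! ### Chains of universal extensions -/

theorem Submodel.mem_range_inclLE {N : K.Model} {S T : Submodel N} (h : S ≤ T) {x : T.model} :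
    x ∈ (inclLE h).range.set ↔ T.incl x ∈ S.set :=
  ⟨fun ⟨y, hy⟩ => hy ▸ y.2, fun hx => ⟨⟨_, hx⟩, rfl⟩⟩

/-- A universal embedding of models embedded compatibly in `N` is a universal inclusion between
their images in `N`. -/
theorem IsUniversal.inclLE_range (hAP : K.AP) {A B N : K.Model} {i : K.Emb A B}
    (hi : IsUniversal i) (hB : K.LS ≤ #B) (a : K.Emb A N) (b : K.Emb B N)
    (hab : ∀ x, b (i x) = a x) :
    ∃ h : a.range ≤ b.range, IsUniversal (Submodel.inclLE h) := by
  have h : a.range ≤ b.range := by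
    rintro _ ⟨x, rfl⟩
    exact ⟨i x, hab x⟩
  refine ⟨h, ?_⟩
  have := (hi.comp_right hAP hB (Emb.ofEquiv a.equivRange.symm)).comp_left
    (Emb.ofEquiv b.equivRange) b.mk_range_model
  convert this using 1
  ext x
  obtain ⟨y, rfl⟩ := a.equivRange.surjective x
  simp only [Emb.comp_apply, Emb.ofEquiv_apply, FirstOrder.Language.Equiv.symm_apply_apply]
  exact Subtype.ext (hab y).symm

namespace IsUChain

variable {μ : Cardinal.{u}} {δ γ : Ordinal.{u}} {N : K.Model} {S : Ordinal.{u} → Submodel N}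

/-- The tail of a `u`-chain is a `u`-chain. -/
theorem tail (h : IsUChain μ δ N S) {j : Ordinal.{u}} (hj : j + γ = δ) :
    IsUChain μ γ N fun i => S (j + i) where
  mono a b hab hb := h.mono _ _ (by gcongr) (hj ▸ by gcongr)
  card i hi := h.card _ (hj ▸ by gcongr)
  cont i hi hl := by
    rw [h.cont _ (hj ▸ by gcongr) (Ordinal.isSuccLimit_add j hl)]
    ext x
    simp only [Set.mem_iUnion, Set.mem_Iio, exists_prop]
    constructor
    · rintro ⟨k, hk, hx⟩
      have hi0 : 0 < i := by simpa using hl.bot_lt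
      rcases le_total j k with hjk | hjk
      · refine ⟨k - j, (Ordinal.sub_lt_of_le hjk).2 hk, ?_⟩
        rwa [Ordinal.add_sub_cancel_of_le hjk]
      · refine ⟨0, hi0, ?_⟩
        rw [add_zero]
        exact h.mono k j hjk (hj ▸ le_self_add) hx
    · rintro ⟨k, hk, hx⟩
      exact ⟨j + k, by gcongr, hx⟩
  univ i hi := by
    have := h.univ (j + i) (hj ▸ by gcongr)
    rwa [add_assoc] at this
  last := by rw [hj]; exact h.last

/-- An initial segment of a `u`-chain, viewed inside its last member, is a `u`-chain. -/
theorem truncate (hAP : K.AP) (hμ : K.LS ≤ μ) (h : IsUChain μ δ N S) (hγ : γ ≤ δ) :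
    IsUChain μ γ (S γ).model fun i =>
      (Submodel.inclLE (h.mono (min i γ) γ (min_le_right _ _) hγ)).range where
  mono a b hab hb := fun x hx => by
    rw [← SetLike.mem_coe] at hx ⊢
    have hx := (Submodel.mem_range_inclLE _).1 hx
    exact (Submodel.mem_range_inclLE _).2
      (h.mono _ _ (min_le_min_right _ hab) ((min_le_right _ _).trans hγ) hx)
  card i hi := (Emb.mk_range_model _).trans (h.card _ ((min_le_right _ _).trans hγ))
  cont i hi hl := by
    ext x
    simp only [Submodel.mem_range_inclLE, Set.mem_iUnion, Set.mem_Iio, exists_prop]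
    rw [min_eq_left hi, h.cont i (hi.trans hγ) hl]
    simp only [Set.mem_iUnion, Set.mem_Iio, exists_prop]
    refine exists_congr fun j => and_congr_right fun hj => ?_
    rw [min_eq_left (hj.le.trans hi)]
  univ i hi := by
    have hu : ∃ hle : S (min i γ) ≤ S (min (i + 1) γ), IsUniversal (Submodel.inclLE hle) := by
      rw [min_eq_left hi.le, min_eq_left (Order.add_one_le_of_lt hi)]
      exact h.univ i (hi.trans_le hγ)
    obtain ⟨_, hu⟩ := hu
    exact hu.inclLE_range hAP (hμ.trans (h.card _ ((min_le_right _ _).trans hγ)).ge) _ _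
      fun x => rfl
  last := by
    ext x
    simp only [Submodel.mem_range_inclLE, Set.mem_univ, iff_true, min_self]
    exact x.2

/-- Earlier members of a `u`-chain have later members as universal extensions. -/
theorem isUniversal_of_lt (h : IsUChain μ δ N S) {i j : Ordinal.{u}} (hij : i < j) (hj : j ≤ δ)
    (hle : S i ≤ S j) : IsUniversal (Submodel.inclLE hle) := by
  have hi : i + 1 ≤ j := Order.add_one_le_of_lt hij
  obtain ⟨h₁, hu⟩ := h.univ i (hij.trans_le hj)
  exact hu.comp_left (Submodel.inclLE (h.mono _ _ hi hj))
    ((h.card j hj).trans (h.card _ (hi.trans hj)).symm)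

theorem mk_eq (h : IsUChain μ δ N S) : #N = μ := by
  rw [← h.card δ le_rfl, ← Cardinal.mk_univ, ← h.last]
  rfl

/-- If `j + ω ≤ δ`, then the member of index `j + ω` of a `u`-chain is a limit model. -/
theorem isLimitModel (hAP : K.AP) (hμ : K.LS ≤ μ) (h : IsUChain μ δ N S) {j : Ordinal.{u}}
    (hj : j + Ordinal.omega0 ≤ δ) : IsLimitModel μ (S (j + Ordinal.omega0)).model := by
  refine ⟨ℵ₀, Cardinal.isRegular_aleph0, Order.lt_succ_of_le (aleph0_le_LS.trans hμ), ?_⟩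
  rw [Cardinal.ord_aleph0]
  exact ⟨_, (h.truncate hAP hμ hj).tail rfl⟩

end IsUChain

theorem IsLimitModel.mk_eq {μ : Cardinal.{u}} {N : K.Model} (h : IsLimitModel μ N) : #N = μ := by
  obtain ⟨α, -, -, S, hS⟩ := h
  exact hS.mk_eq

/-- A sequence of universal extensions in `K_μ` with union `N` is a `u`-chain of length `ω`. -/
theorem exists_isUChain_omega0 {μ : Cardinal.{u}} (hμ : ℵ₀ ≤ μ) {N : K.Model}
    (A : ℕ → Submodel N) (hc : ∀ n, #(A n).model = μ)
    (hA : ∀ n, ∃ h : A n ≤ A (n + 1), IsUniversal (Submodel.inclLE h))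
    (hN : ∀ x, ∃ n, x ∈ (A n).set) :
    ∃ S, IsUChain μ Ordinal.omega0 N S ∧ ∀ n : ℕ, S n = A n := by
  classical
  let T : Submodel N := ⟨⊤, K.strong_top N.isModel⟩
  have hmono : ∀ {m n}, m ≤ n → A m ≤ A n := fun {m n} h =>
    (monotone_nat_of_le_succ (f := fun n => (A n).toSubstructure) fun n => (hA n).1) h
  let S : Ordinal.{u} → Submodel N := fun i =>
    if h : ∃ n : ℕ, i = n then A h.choose else T
  have hS : ∀ n : ℕ, S n = A n := fun n => by
    have h : ∃ m : ℕ, (n : Ordinal.{u}) = m := ⟨n, rfl⟩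
    have : h.choose = n := by exact_mod_cast h.choose_spec.symm
    simp only [S, dif_pos h, this]
  have hST : S Ordinal.omega0 = T := dif_neg fun ⟨n, hn⟩ => (Ordinal.natCast_lt_omega0 n).ne' hn
  have hcases : ∀ {i : Ordinal.{u}}, i ≤ Ordinal.omega0 →
      (∃ n : ℕ, i = n) ∨ i = Ordinal.omega0 := fun {i} hi =>
    hi.lt_or_eq.imp_left Ordinal.lt_omega0.1
  have hTop : ∀ A : Submodel N, A ≤ T := fun A x _ => trivial
  refine ⟨S, ⟨fun i j hij hj => ?_, fun i hi => ?_, fun i hi hl => ?_, fun i hi => ?_, ?_⟩, hS⟩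
  · rcases hcases hj with ⟨n, rfl⟩ | rfl
    · obtain ⟨m, rfl⟩ := Ordinal.lt_omega0.1 (hij.trans_lt (Ordinal.natCast_lt_omega0 n))
      rw [hS, hS]
      exact hmono (by exact_mod_cast hij)
    · rw [hST]
      exact hTop _
  · rcases hcases hi with ⟨n, rfl⟩ | rfl
    · rw [hS, hc]
    · rw [hST]
      refine le_antisymm ?_ ?_
      · have h₁ : (Set.univ : Set N) = ⋃ n, (A n).set :=
          (Set.eq_univ_of_forall fun x => Set.mem_iUnion.2 (hN x)).symm
        have h₂ : #T.model = #(⋃ n : ULift.{u} ℕ, (A n.down).set : Set N) := by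
          have : (⋃ n : ULift.{u} ℕ, (A n.down).set) = T.set := by
            refine Set.eq_univ_of_forall fun x => ?_
            obtain ⟨n, hn⟩ := hN x
            exact Set.mem_iUnion.2 ⟨⟨n⟩, hn⟩
          rw [this]
          rfl
        rw [h₂]
        refine (Cardinal.mk_iUnion_le _).trans (Cardinal.mul_le_of_le hμ ?_ ?_)
        · simpa using hμ
        · exact ciSup_le' fun n => (hc n.down).le
      · rw [← hc 0]
        exact Cardinal.mk_le_of_injective (Submodel.inclLE (hTop (A 0))).injective
  · rcases hcases hi with ⟨n, rfl⟩ | rfl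
    · exact absurd (Ordinal.omega0_le_of_isSuccLimit hl) (Ordinal.natCast_lt_omega0 n).not_ge
    · rw [hST]
      refine (Set.eq_univ_of_forall fun x => ?_).symm
      obtain ⟨n, hn⟩ := hN x
      exact Set.mem_biUnion (Set.mem_Iio.2 (Ordinal.natCast_lt_omega0 n)) (by rwa [hS])
  · obtain ⟨n, rfl⟩ := Ordinal.lt_omega0.1 hi
    have : ((n : Ordinal.{u}) + 1) = (n + 1 : ℕ) := by push_cast; rfl
    rw [this, hS, hS]
    exact hA n
  · rw [hST]
    rfl

/-! ### Types of infinite rank -/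

/-- Forking extensions of `p` transfer along an isomorphism of the base. -/
theorem isForkingExt_comp_equiv (hAP : K.AP) {μ : Cardinal.{u}} (hμ : K.LS ≤ μ)
    {M M' P : K.Model} (e : M ≃[L] M') (hM : #M = μ) (hP : #P = μ) {i : K.Emb M' P} {p : GType M}
    {q : GType P} (h : (K.limitNonforking μ).IsForkingExt i (p.map e) q) :
    (K.limitNonforking μ).IsForkingExt (i.comp (Emb.ofEquiv e)) p q := by
  obtain ⟨hdom, hle, hq, hf⟩ := h
  have hM' : #M' = μ := (Cardinal.mk_congr e.toEquiv).symm.trans hM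
  refine ⟨hdom, hle.imp (fun hi => hi.comp_right hAP (hP ▸ hμ) _) fun hi => ?_, ?_, fun hd => hf ?_⟩
  · exact hi.comp e.surjective
  · rw [← GType.restrict_restrict, hq, GType.restrict_map]
  · obtain ⟨M₀, h₀, hu, hs⟩ := hd
    exact DoesNotFork.of_emb hAP hμ ((Emb.ofEquiv e).comp M₀.incl) h₀ hM'
      (hu.comp_left _ (hM'.trans hM.symm)) hs

/-- The rank is invariant under isomorphism. -/
theorem uRankGE_of_map (hAP : K.AP) {μ : Cardinal.{u}} (hμ : K.LS ≤ μ) {M M' : K.Model}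
    (e : M ≃[L] M') (hM : #M = μ) {p : GType M} {α : Ordinal.{u}}
    (h : (K.limitNonforking μ).URankGE α M' (p.map e)) :
    (K.limitNonforking μ).URankGE α M p := by
  have hM' : #M' = μ := (Cardinal.mk_congr e.toEquiv).symm.trans hM
  induction α using Ordinal.limitRecOn with
  | zero => exact IndepRel.uRankGE_zero _ _
  | add_one β _ =>
    obtain ⟨P, i, q, hP, hf, hq⟩ := (IndepRel.uRankGE_add_one _ _ _).1 h
    exact (IndepRel.uRankGE_add_one _ _ _).2 ⟨P, _, q, hP.trans (hM'.trans hM.symm),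
      isForkingExt_comp_equiv hAP hμ e hM (hP.trans hM') hf, hq⟩
  | limit β hβ ih =>
    exact (IndepRel.uRankGE_limit _ _ _ hβ).2 fun γ hγ =>
      ih γ hγ ((IndepRel.uRankGE_limit _ _ _ hβ).1 h γ hγ)

theorem small_gType {μ : Cardinal.{u}} (hst : K.StableIn μ) {M : K.Model} (hM : #M = μ) :
    Small.{u} (GType M) := by
  have h := hst M hM
  rw [← hM, ← Cardinal.mk_uLift] at h
  obtain ⟨f⟩ := h
  exact small_of_injective f.injective

/-- A type of infinite rank has a forking extension of infinite rank. Up to isomorphism there is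
only a set of types over models of size `μ`, by stability, so the ordinal ranks of these types are
bounded. -/
theorem exists_isForkingExt_of_forall_uRankGE (hAP : K.AP) {μ : Cardinal.{u}} (hμ : K.LS ≤ μ)
    (hst : K.StableIn μ) {M : K.Model} (hM : #M = μ) {p : GType M}
    (hp : ∀ α, (K.limitNonforking μ).URankGE α M p) :
    ∃ (M' : K.Model) (i : K.Emb M M') (p' : GType M'),
      (K.limitNonforking μ).IsForkingExt i p p' ∧
      ∀ α, (K.limitNonforking μ).URankGE α M' p' := by
  classical
  -- the models on a fixed underlying set of size `μ`
  let I := {s : L.Structure μ.out // @AEC.IsModel L K μ.out s}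
  let mod : I → K.Model := fun s => @Model.mk L K μ.out s.1 s.2
  have hmod : ∀ s, #(mod s) = μ := fun s => Cardinal.mk_out μ
  have : ∀ s, Small.{u} (GType (mod s)) := fun s => small_gType hst (hmod s)
  let b : (Σ s, GType (mod s)) → Ordinal.{u} := fun x =>
    if h : ∃ β, ¬ (K.limitNonforking μ).URankGE β _ x.2 then h.choose else 0
  obtain ⟨γ, hγ⟩ := Ordinal.bddAbove_of_small (s := Set.range b)
  obtain ⟨M', i, p', hc, hf, hr⟩ := (IndepRel.uRankGE_add_one _ _ γ).1 (hp (γ + 1))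
  refine ⟨M', i, p', hf, ?_⟩
  by_contra! hβ
  obtain ⟨β, hβ⟩ := hβ
  have hM' : #M' = μ := hc.trans hM
  obtain ⟨e₀⟩ := Cardinal.eq.1 (hM'.trans (Cardinal.mk_out μ).symm)
  let str : L.Structure μ.out := e₀.inducedStructure
  let e : M' ≃[L] μ.out := e₀.inducedStructureEquiv
  let s : I := ⟨str, K.isModel_of_equiv e M'.isModel⟩
  let e' : M' ≃[L] mod s := e
  have hx : ∃ β, ¬ (K.limitNonforking μ).URankGE β (mod s) (p'.map e') :=
    ⟨β, fun h => hβ (uRankGE_of_map hAP hμ e' hM' h)⟩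
  have hb : ¬ (K.limitNonforking μ).URankGE (b ⟨s, p'.map e'⟩) (mod s) (p'.map e') := by
    simp only [b, dif_pos hx]
    exact hx.choose_spec
  refine hb (IndepRel.uRankGE_antitone _ _ (hγ ⟨_, rfl⟩) ?_)
  refine uRankGE_of_map hAP hμ e'.symm (hmod s) ?_
  have : (p'.map e').map e'.symm = p' := GType.restrict_map e' p'
  rwa [this]

/-! ### Superstability bounds the rank -/

/-- In the superstable case a type over a limit model does not fork over that model, so a forking
extension of types over limit models lives on a universal extension of the base. -/
theorem isUniversal_of_isForkingExt (hAP : K.AP) {μ : Cardinal.{u}} (hμ : K.LS ≤ μ)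
    (hlc : K.LocalCharacter ℵ₀ μ) {M M' : K.Model} {i : K.Emb M M'} {p : GType M} {p' : GType M'}
    (h : (K.limitNonforking μ).IsForkingExt i p p') : IsUniversal i := by
  obtain ⟨hdom, hle, -, hf⟩ := h
  refine hle.resolve_right fun hs => hf ?_
  have hM' : #M' = μ := IsLimitModel.mk_eq hdom
  obtain ⟨α, hα, -, S, hS⟩ := hdom
  have hlim : Order.IsSuccLimit α.ord := Cardinal.isSuccLimit_ord hα.aleph0_le
  obtain ⟨j, hj, hns⟩ := hlc _ _ _ hlim
    (Ordinal.aleph0_le_cof_iff.2 (Ordinal.one_lt_cof_iff.2 hlim)) hS p'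
  obtain ⟨e, rfl⟩ := i.exists_equiv hs
  have hM : #M = μ := (Cardinal.mk_congr e.toEquiv).trans hM'
  obtain ⟨hle, hu⟩ := hS.univ j hj
  have hj₁ : j + 1 ≤ α.ord := Order.add_one_le_of_lt hj
  have hu' := hu.comp_left (S (j + 1)).incl (hM'.trans (hS.card _ hj₁).symm)
  refine DoesNotFork.of_emb hAP hμ ((Emb.ofEquiv e.symm).comp (S j).incl) (hS.card _ hj.le) hM
    (hu'.comp_left _ (hM.trans hM'.symm)) fun hsp => hns (hsp.mono_base fun m => ⟨m, ?_⟩)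
  simp

/-- A sequence of types, each extending the previous one, has a common extension to the union of
the domains; here the types come with coherent realizations. -/
theorem exists_limit_type {M : ℕ → K.Model} (a : ∀ n, TypeRep (M n))
    (i : ∀ n, K.Emb (M n) (M (n + 1))) (f : ∀ n, K.Emb (a n).amb (a (n + 1)).amb)
    (hf : ∀ n m, f n ((a n).emb m) = (a (n + 1)).emb (i n m))
    (hpt : ∀ n, f n (a n).pt = (a (n + 1)).pt) :
    ∃ (W : K.Model) (g : ∀ n, K.Emb (M n) W) (q : GType W),
      (∀ n m, g (n + 1) (i n m) = g n m) ∧ (∀ x, ∃ n m, g n m = x) ∧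
      ∀ n, q.restrict (g n) = Quot.mk _ (a n) := by
  obtain ⟨U, k, hk⟩ := exists_colimit f
  have hstep : ∀ n m, (k (n + 1)).comp (a (n + 1)).emb (i n m) = (k n).comp (a n).emb m :=
    fun n m => by simp [← hf, hk]
  obtain ⟨T, hT⟩ := exists_union (fun n => ((k n).comp (a n).emb).range) fun n => by
    rintro _ ⟨m, rfl⟩
    exact ⟨i n m, hstep n m⟩
  have hle : ∀ n m, ∃ y, T.incl y = (k n).comp (a n).emb m := fun n m =>
    Submodel.mem_set_iff.1 (hT ▸ Set.mem_iUnion.2 ⟨n, m, rfl⟩)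
  choose g hg using fun n => Emb.exists_factor _ T.incl (hle n)
  have hkpt : ∀ n, k n (a n).pt = k 0 (a 0).pt := fun n => by
    induction n with
    | zero => rfl
    | succ n ih => rw [← hpt, hk, ih]
  refine ⟨T.model, g, Quot.mk _ ⟨U, T.incl, k 0 (a 0).pt⟩, fun n m => ?_, fun x => ?_, fun n => ?_⟩
  · exact T.incl.injective (by rw [hg, hg, hstep])
  · have hx : T.incl x ∈ ⋃ n, ((k n).comp (a n).emb).range.set := hT ▸ x.2
    obtain ⟨n, m, hm⟩ := Set.mem_iUnion.1 hx
    exact ⟨n, m, T.incl.injective ((hg n m).trans hm)⟩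
  · rw [GType.restrict_mk]
    exact (GType.mk_eq_mk_of_emb (k n) (fun m => (hg n m).symm) (hkpt n)).symm

/-- A realization of `p` can be prolonged to a realization of a given extension of `p`. -/
theorem exists_realization (hAP : K.AP) {M M' : K.Model} (a : TypeRep M) (i : K.Emb M M')
    (p' : GType M') (h : p'.restrict i = Quot.mk _ a) :
    ∃ (a' : TypeRep M') (f : K.Emb a.amb a'.amb), p' = Quot.mk _ a' ∧
      (∀ m, f (a.emb m) = a'.emb (i m)) ∧ f a.pt = a'.pt := by
  induction p' using Quot.ind with
  | mk c =>
    obtain ⟨P, g, f, hm, hp⟩ := (GType.mk_eq_mk_iff hAP).1 h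
    exact ⟨⟨P, g.comp c.emb, g c.pt⟩, f, GType.mk_eq_mk_of_emb g (fun _ => rfl) rfl,
      fun m => (hm m).symm, hp.symm⟩

/-- An infinite sequence of forking extensions contradicts `ℵ₀`-local character: the union of the
types does not split over some member of the chain, so a later type in the sequence does
not fork. -/
theorem not_exists_forking_sequence (hAP : K.AP) {μ : Cardinal.{u}} (hμ : K.LS ≤ μ)
    (hlc : K.LocalCharacter ℵ₀ μ) {M : ℕ → K.Model} (a : ∀ n, TypeRep (M n))
    (i : ∀ n, K.Emb (M n) (M (n + 1))) (f : ∀ n, K.Emb (a n).amb (a (n + 1)).amb)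
    (hf : ∀ n m, f n ((a n).emb m) = (a (n + 1)).emb (i n m))
    (hpt : ∀ n, f n (a n).pt = (a (n + 1)).pt) (hc : ∀ n, #(M n) = μ)
    (hfork : ∀ n, (K.limitNonforking μ).IsForkingExt (i n) (Quot.mk _ (a n))
      (Quot.mk _ (a (n + 1)))) : False := by
  obtain ⟨W, g, q, hg, hW, hq⟩ := exists_limit_type a i f hf hpt
  have hu : ∀ n, IsUniversal (i n) := fun n => isUniversal_of_isForkingExt hAP hμ hlc (hfork n)
  obtain ⟨S, hS, hSn⟩ := exists_isUChain_omega0 (aleph0_le_LS.trans hμ) (fun n => (g n).range)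
    (fun n => (g n).mk_range_model.trans (hc n))
    (fun n => (hu n).inclLE_range hAP (hc (n + 1) ▸ hμ) _ _ (hg n))
    (fun x => (hW x).imp fun n hn => hn)
  obtain ⟨j, hj, hns⟩ := hlc _ _ _ Ordinal.isSuccLimit_omega0
    (Ordinal.aleph0_le_cof_iff.2 (Ordinal.one_lt_cof_iff.2 Ordinal.isSuccLimit_omega0)) hS q
  obtain ⟨n, rfl⟩ := Ordinal.lt_omega0.1 hj
  refine (hfork (n + 1)).2.2.2 (DoesNotFork.of_emb hAP hμ (i n) (hc n) (hc _) (hu n) fun hs => ?_)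
  rw [hSn] at hns
  rw [← hq] at hs
  refine hns (hs.of_restrict.mono_base fun m => ?_)
  obtain ⟨m, rfl⟩ := (g n).equivRange.surjective m
  exact ⟨m, (hg _ _).trans (hg _ _)⟩

/-- Superstability makes all ranks ordinals. -/
theorem Superstable.uRank_lt_top (hAP : K.AP) {μ : Cardinal.{u}} (h : K.Superstable μ)
    {M : K.Model} (hM : IsLimitModel μ M) (p : GType M) :
    (K.limitNonforking μ).URank p < ⊤ := by
  obtain ⟨hμ, hst, hlc⟩ := h
  refine lt_top_iff_ne_top.2 fun htop => ?_
  induction p using Quot.ind with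
  | mk a₀ =>
    let X := {x : Σ M : K.Model, TypeRep M // IsLimitModel μ x.1 ∧
      ∀ α, (K.limitNonforking μ).URankGE α x.1 (Quot.mk _ x.2)}
    have hstep : ∀ x : X, ∃ (y : X) (i : K.Emb x.1.1 y.1.1) (f : K.Emb x.1.2.amb y.1.2.amb),
        (∀ m, f (x.1.2.emb m) = y.1.2.emb (i m)) ∧ f x.1.2.pt = y.1.2.pt ∧
        (K.limitNonforking μ).IsForkingExt i (Quot.mk _ x.1.2) (Quot.mk _ y.1.2) := by
      rintro ⟨⟨M, a⟩, hM, ha⟩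
      obtain ⟨M', i, p', hf, hp'⟩ :=
        exists_isForkingExt_of_forall_uRankGE hAP hμ hst hM.mk_eq ha
      obtain ⟨a', f, rfl, hfm, hfp⟩ := exists_realization hAP a i p' hf.2.2.1
      exact ⟨⟨⟨M', a'⟩, hf.1, hp'⟩, i, f, hfm, hfp, hf⟩
    choose next i f hf hpt hfork using hstep
    let x₀ : X := ⟨⟨M, a₀⟩, hM, fun α =>
      ((K.limitNonforking μ).le_uRank_iff _ α).1 (htop ▸ le_top)⟩
    let x : ℕ → X := fun n => Nat.rec x₀ (fun _ y => next y) n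
    exact not_exists_forking_sequence hAP hμ hlc (fun n => (x n).1.2) (fun n => i (x n))
      (fun n => f (x n)) (fun n => hf (x n)) (fun n => hpt (x n))
      (fun n => (x n).2.1.mk_eq) (fun n => hfork (x n))

/-! ### Bounded rank implies superstability -/

theorem exists_add_eq_of_isSuccLimit {j δ : Ordinal.{u}} (hδ : Order.IsSuccLimit δ) (hj : j < δ) :
    ∃ γ, j + γ = δ ∧ Order.IsSuccLimit γ :=
  ⟨δ - j, Ordinal.add_sub_cancel_of_le hj.le, Ordinal.isSuccLimit_sub hδ.isSuccPrelimit hj⟩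

/-- By continuity, a type over the last member of a `u`-chain that splits over `S i` has a
restriction to a later member of the chain that splits over `S i`. -/
theorem exists_splits_restrict {μ : Cardinal.{u}} (hcont : K.ContinuityNonsplitting μ)
    {δ : Ordinal.{u}} {N : K.Model} {S : Ordinal.{u} → Submodel N} (hδ : Order.IsSuccLimit δ)
    (hS : IsUChain μ δ N S) {p : GType N} {i : Ordinal.{u}} (hi : i < δ)
    (hp : Splits μ (S i).incl p) :
    ∃ j, i < j ∧ j < δ ∧ ∃ hle : S i ≤ S j,
      Splits μ (Submodel.inclLE hle) (p.restrict (S j).incl) := by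
  obtain ⟨γ, rfl, hγ⟩ := exists_add_eq_of_isSuccLimit hδ hi
  by_contra! H
  refine hcont γ N _ hγ (hS.tail rfl) p (fun k hk h hs => ?_)
    (hp.mono_base fun m => ⟨⟨m.1, by simpa using m.2⟩, rfl⟩)
  have hj : i + k + 1 < i + γ := hδ.add_one_lt (by gcongr)
  have hij : i < i + k + 1 := Order.lt_add_one_iff.2 le_self_add
  have hle := hS.mono (i + k) _ le_self_add hj.le
  refine H _ hij hj (hS.mono _ _ hij.le hj.le) ?_
  rw [← Submodel.incl_comp_inclLE hle, ← GType.restrict_restrict] at hs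
  exact hs.of_restrict.mono_base fun m => ⟨⟨m.1, by simpa using m.2⟩, rfl⟩

/-- If `p` splits over every member of a `u`-chain, then its restrictions to limit models inside
proper initial members have infinite rank. Given such a limit model inside `S i`, the restriction of
`p` to some `S j` splits over `S i`; the limit model `S (j + ω)` has a copy over `S j` inside
`S (j + 1)`, and the restriction of `p` to that copy is a forking extension of the same kind. -/
theorem uRankGE_of_forall_splits (hAP : K.AP) {μ : Cardinal.{u}} (hμ : K.LS ≤ μ)
    (hcont : K.ContinuityNonsplitting μ) {δ : Ordinal.{u}} {N : K.Model}
    {S : Ordinal.{u} → Submodel N} (hδ : Order.IsSuccLimit δ) (hS : IsUChain μ δ N S) {p : GType N}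
    (hp : ∀ i < δ, Splits μ (S i).incl p) (α : Ordinal.{u}) {i : Ordinal.{u}} (hi : i < δ)
    {M : K.Model} (hM : #M = μ) (g : K.Emb M (S i).model) :
    (K.limitNonforking μ).URankGE α M (p.restrict ((S i).incl.comp g)) := by
  induction α using Ordinal.limitRecOn generalizing i M with
  | zero => exact IndepRel.uRankGE_zero _ _
  | limit α hα ih =>
    exact (IndepRel.uRankGE_limit _ _ _ hα).2 fun β hβ => ih β hβ hi hM g
  | add_one α ih =>
    obtain ⟨j, hij, hj, hle, hs⟩ := exists_splits_restrict hcont hδ hS hi (hp i hi)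
    have hjω : j + Ordinal.omega0 ≤ δ := by
      obtain ⟨γ, rfl, hγ⟩ := exists_add_eq_of_isSuccLimit hδ hj
      gcongr
      exact Ordinal.omega0_le_of_isSuccLimit hγ
    have hlim := hS.isLimitModel hAP hμ hjω
    have hj₁ : j + 1 < δ := hδ.add_one_lt hj
    let l := Submodel.inclLE (hS.mono j _ le_self_add hjω)
    obtain ⟨hle₁, hu⟩ := hS.univ j hj
    obtain ⟨g', hg'⟩ := hu.2 _ l (hlim.mk_eq.trans (hS.card _ hj₁.le).symm)
    have hl : ((S (j + 1)).incl.comp g').comp l = (S j).incl := by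
      ext m
      exact congrArg (S (j + 1)).incl (hg' m)
    let k := l.comp ((Submodel.inclLE hle).comp g)
    refine (IndepRel.uRankGE_add_one _ _ _).2 ⟨_, k, p.restrict ((S (j + 1)).incl.comp g'),
      hlim.mk_eq.trans hM.symm, ⟨hlim, .inl ?_, ?_, ?_⟩, ih hj₁ hlim.mk_eq g'⟩
    · exact ((hS.isUniversal_of_lt hij hj.le hle).comp_right hAP
        (hμ.trans (hS.card j hj.le).ge) g).comp_left l (hlim.mk_eq.trans (hS.card j hj.le).symm)
    · have : ((S (j + 1)).incl.comp g').comp k = (S i).incl.comp g := by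
        ext m
        exact congrArg (S (j + 1)).incl (hg' _)
      rw [GType.restrict_restrict, this]
    · rintro ⟨M₀, -, -, hns⟩
      rw [← hl, ← GType.restrict_restrict] at hs
      exact hns (hs.of_restrict.mono_base fun m => ⟨g (M₀.incl m), rfl⟩)

/-- If all ranks over limit models are ordinals, then nonsplitting has `ℵ₀`-local character. -/
theorem localCharacter_of_uRank_lt_top (hAP : K.AP) {μ : Cardinal.{u}} (hμ : K.LS ≤ μ)
    (hcont : K.ContinuityNonsplitting μ)
    (hU : ∀ M : K.Model, IsLimitModel μ M → ∀ p : GType M, (K.limitNonforking μ).URank p < ⊤) :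
    K.LocalCharacter ℵ₀ μ := by
  intro δ N S hδ _ hS p
  by_contra! hp
  have h₀ : 0 < δ := by simpa using hδ.bot_lt
  have h₁ : 0 + 1 < δ := hδ.add_one_lt h₀
  have hω : 0 + Ordinal.omega0 ≤ δ := by
    simpa using Ordinal.omega0_le_of_isSuccLimit hδ
  have hlim := hS.isLimitModel hAP hμ hω
  obtain ⟨_, hu⟩ := hS.univ 0 h₀
  obtain ⟨g, -⟩ := hu.2 _ (Submodel.inclLE (hS.mono 0 _ le_self_add hω))
    (hlim.mk_eq.trans (hS.card _ h₁.le).symm)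
  refine (hU _ hlim (p.restrict ((S (0 + 1)).incl.comp g))).ne (WithTop.eq_top_iff_forall_ge.2
    fun α => (IndepRel.le_uRank_iff _ _ α).2 ?_)
  exact uRankGE_of_forall_splits hAP hμ hcont hδ hS hp α h₁ hlim.mk_eq g

end AEC

theorem mainTheorem9 {L : FirstOrder.Language.{u, u}} (K : AEC L)
    (hAP : K.AP) (hJEP : K.JEP) (hNMM : K.NMM)
    (μ : Cardinal.{u}) (hμ : K.LS ≤ μ) (hstable : K.StableIn μ) (htame : K.Tame μ)
    (hcont : K.ContinuityNonsplitting μ)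
    (χ : Cardinal.{u}) (hχ : K.IsMinLocalCharacter χ μ) (hχμ : χ ≤ μ) :
    K.Superstable μ ↔
      ∀ M : K.Model, AEC.IsLimitModel μ M → ∀ p : AEC.GType M,
        (K.limitNonforking μ).URank p < ⊤ :=
  ⟨fun h _ hM p => h.uRank_lt_top hAP hM p,
    fun hU => ⟨hμ, hstable, AEC.localCharacter_of_uRank_lt_top hAP hμ hcont hU⟩⟩
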